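/- Let $\Phi(\zeta,s,v)$ be the Hurwitz--Lerch zeta function, i.e. $\Phi(\zeta,s,v)=\sum_{k\ge 0}(v+k)^{-s}\zeta^k$ for $|\zeta|<1$, continued by $$\Phi(\zeta,s,v)=\frac1{\Gamma(s)}\int_0^\infty\frac{t^{s-1}e^{-(v-1)t}}{e^t-\zeta}\,dt$$ for $\operatorname{Re}v>0$ and $|\zeta|\le 1$, $\zeta\ne1$, $\operatorname{Re}s>0$ (or $\zeta=1$, $\operatorname{Re}s>1$). Write $\Phi'(\zeta,s,v)=\partial\Phi(\zeta,s,v)/\partial s$; for $\zeta=-1$, $s=1$ and every real $v>0$ this derivative exists. Let $\gamma$ be Euler's constant and let $\log$ be the principal branch of the complex logarithm. (a) For all integers $n\ge 0$ and $z\ge 1$, $$\begin{aligned} &\sum_{p=0}^{n}\sum_{j=1}^{z}2i\,e^{i\pi(j+z)}(2z+1)^{-p}\Big(-\Phi'\big(-1,1,\tfrac12-\tfrac{j}{2z+1}\big)-\Phi'\big(-1,1,\tfrac{j}{2z+1}+\tfrac12\big)+\pi\sec\big(\tfrac{\pi j}{2z+1}\big)\log\big(i(2z+1)^p\big)\Big)\\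 &\quad-i\pi\big((-1)^z-1\big)\sum_{p=0}^{n}(2z+1)^{-p}\log\Big(-\frac{i e^{\gamma}\pi^3(2z+1)^{-p}}{32\,\Gamma(5/4)^4}\Big)\\ &=-i\pi(2z+1)^{-n}\left((2z+1)^{n+1}\log\Big(-\frac{8i e^{\gamma}\pi^3(2z+1)}{\Gamma(1/4)^4}\Big)+\log\Big(\frac{32i e^{-\gamma}\Gamma(5/4)^4(2z+1)^n}{\pi^3}\Big)\right). \end{aligned}$$ (b) In particular (from $n=2$, $z=1$), $$\exp\left(-\frac{13\big(\Phi'(-1,1,\tfrac16)+\Phi'(-1,1,\tfrac56)\big)}{54\pi}\right)=\frac{2^{11/27}\,e^{-13\gamma/27}\,\Gamma(1/4)\,\Gamma(5/4)^{25/27}}{3^{13/36}\,\pi^{13/9}}.$$ -/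

import Mathlib

open MeasureTheory Set

/-- The Hurwitz-Lerch zeta function `Φ(z, s, v)`: the power series `∑ (v + n)^(-s) z^n` in the open
unit disc `|z| < 1` (where `v ≠ 0, -1, -2, …`), and its continuation by the integral
`Γ(s)⁻¹ ∫₀^∞ t^(s-1) e^(-(v-1)t) / (e^t - z) dt` for `|z| = 1`, `z ≠ 1`, `Re v > 0`, `Re s > 0`
(and for `z = 1`, `Re v > 0`, `Re s > 1`). Outside these ranges the value has no meaning. -/
noncomputable def lerchPhi (z s v : ℂ) : ℂ :=
  open Classical in
  if ‖z‖ < 1 then ∑' n : ℕ, (v + n) ^ (-s) * z ^ n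
  else (Complex.Gamma s)⁻¹ *
    ∫ t in Ioi (0 : ℝ), (t : ℂ) ^ (s - 1) * Complex.exp (-(v - 1) * t) / (Complex.exp t - z)

/-- `Φ'(z, s, v) = ∂Φ/∂s (z, s, v)`, the partial derivative in the second argument. -/
noncomputable def lerchPhiDeriv (z s v : ℂ) : ℂ :=
  deriv (fun w : ℂ => lerchPhi z w v) s

/-- The secant function. -/
noncomputable def csec (x : ℂ) : ℂ := 1 / Complex.cos x

open Filter Topology Asymptotics HurwitzZeta

/-! Write `M = 2z+1`, `L = log M` and `C = log (8 e^γ π³ / Γ(1/4)⁴)`. For `Re v > 0`, `Γ(s)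
Φ(-1,s,v)` is the Mellin transform of `e^{-(v-1)t}/(e^t+1)`, so `Φ(-1,·,v)` is holomorphic on `Re s
> 0`. A finite geometric sum of these kernels gives a multiplication formula: the alternating sum of
`Φ(-1,s,v)` over `M` equally spaced points `v` centred at `1/2` is `M^s Φ(-1,s,1/2)`
(`sum_lerchPhi_neg_one`). Its derivative at `s = 1` reduces the sum over `j` to `Φ(-1,1,1/2) = π/2`
and `Φ'(-1,1,1/2) = (π/2) C`.

The second value is a Kronecker-limit type computation. Since `Φ(-1,s,1/2) = 2^s β(s)` with `β` the
Dirichlet beta function, the functional equation expresses `β'(1)` through `β'(0)`. An absolutely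
convergent second-difference series for `2^s β(s)` on `0 < s ≤ 1` yields `β'(0)` as a sum of
logarithms, which Euler's product for `Γ` evaluates (`hasSum_logSecondDiff`).

The secants are summed by orthogonality of roots of unity (`sum_csec`). All logarithms in (a) have
argument `±i` times a positive real, so no branch problem arises, and the sum over `p` telescopes.
Part (b) is the sum over `j` at `z = 1`, exponentiated. -/

/-! ### Mellin representation and holomorphy in `s`. -/

/-- The function whose Mellin transform is `Γ(s) Φ(-1, s, v)`. -/
noncomputable def lerchKernel (v : ℂ) (t : ℝ) : ℂ :=
  Complex.exp (-(v - 1) * t) / (Complex.exp t + 1)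

theorem lerchPhi_neg_one (s v : ℂ) :
    lerchPhi (-1) s v = (Complex.Gamma s)⁻¹ * mellin (lerchKernel v) s := by
  simp [lerchPhi, mellin, lerchKernel, mul_div_assoc]

theorem exp_ofReal_add_one_ne_zero (t : ℝ) : Complex.exp t + 1 ≠ 0 := by
  have h : (0 : ℝ) < Real.exp t + 1 := by positivity
  exact_mod_cast h.ne'

theorem continuous_lerchKernel (v : ℂ) : Continuous (lerchKernel v) := by
  unfold lerchKernel
  exact Continuous.div (by fun_prop) (by fun_prop) exp_ofReal_add_one_ne_zero

theorem norm_lerchKernel_le (v : ℂ) (t : ℝ) : ‖lerchKernel v t‖ ≤ Real.exp (-v.re * t) := by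
  have h : ‖Complex.exp t + 1‖ = Real.exp t + 1 := by
    have h0 : (0 : ℝ) ≤ Real.exp t + 1 := by positivity
    rw [← abs_of_nonneg h0, ← Real.norm_eq_abs, ← Complex.norm_real]
    push_cast
    rfl
  rw [lerchKernel, norm_div, h, Complex.norm_exp, div_le_iff₀ (by positivity)]
  have h1 : (-(v - 1) * (t : ℂ)).re = -v.re * t + t := by simp; ring
  rw [h1, Real.exp_add]
  gcongr
  linarith

theorem lerchKernel_isBigO_atTop (v : ℂ) :
    lerchKernel v =O[atTop] fun t => Real.exp (-v.re * t) :=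
  IsBigO.of_bound 1 <| Eventually.of_forall fun t => by
    simpa using norm_lerchKernel_le v t

theorem lerchKernel_isBigO_zero (v : ℂ) :
    lerchKernel v =O[𝓝[>] 0] fun t : ℝ => t ^ (-(0 : ℝ)) := by
  simp only [neg_zero, Real.rpow_zero]
  exact ((continuous_lerchKernel v).tendsto 0).isBigO_one ℝ |>.mono nhdsWithin_le_nhds

theorem mellinConvergent_lerchKernel {s v : ℂ} (hv : 0 < v.re) (hs : 0 < s.re) :
    MellinConvergent (lerchKernel v) s :=
  mellinConvergent_of_isBigO_rpow_exp hv
    ((continuous_lerchKernel v).locallyIntegrable.locallyIntegrableOn _)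
    (lerchKernel_isBigO_atTop v) (lerchKernel_isBigO_zero v) hs

theorem differentiableAt_lerchPhi_neg_one {s v : ℂ} (hv : 0 < v.re) (hs : 0 < s.re) :
    DifferentiableAt ℂ (fun w => lerchPhi (-1) w v) s := by
  simp only [lerchPhi_neg_one]
  refine (Complex.differentiable_one_div_Gamma s).mul ?_
  exact mellin_differentiableAt_of_isBigO_rpow_exp hv
    ((continuous_lerchKernel v).locallyIntegrable.locallyIntegrableOn _)
    (lerchKernel_isBigO_atTop v) (lerchKernel_isBigO_zero v) hs

/-! ### The multiplication formula. -/

/-- With `x = e^{t/M}` and `y = e^{t/(2M)}`, the `i`-th kernel is `y x^{M-1-i} / (x^M + 1)`. As `M`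
is odd, the alternating geometric sum of the powers of `x` is `(x^M + 1)/(x + 1)`. -/
theorem sum_lerchKernel (z : ℕ) (t : ℝ) :
    ∑ i ∈ Finset.range (2 * z + 1),
      (-1 : ℂ) ^ i * lerchKernel (1 / 2 + ((i : ℂ) - z) / (2 * z + 1)) t
      = lerchKernel (1 / 2) ((2 * (z : ℝ) + 1)⁻¹ * t) := by
  have hM : (2 * (z : ℂ) + 1) ≠ 0 := by exact_mod_cast (by positivity : (2 * (z : ℝ) + 1) ≠ 0)
  set x : ℂ := Complex.exp (t / (2 * z + 1)) with hx
  set y : ℂ := Complex.exp (t / (2 * (2 * z + 1))) with hy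
  have hxy : y ^ 2 = x := by
    rw [hy, hx, ← Complex.exp_nat_mul]; congr 1; push_cast; field_simp
  have hy0 : y ≠ 0 := Complex.exp_ne_zero _
  have het : Complex.exp t = x ^ (2 * z + 1) := by
    rw [hx, ← Complex.exp_nat_mul]; congr 1; push_cast; field_simp
  have hx1 : x + 1 ≠ 0 := by
    have := exp_ofReal_add_one_ne_zero (t / (2 * z + 1))
    push_cast at this; exact this
  have hX : x ^ (2 * z + 1) + 1 ≠ 0 := by
    rw [← het]; exact exp_ofReal_add_one_ne_zero t
  have hR : lerchKernel (1 / 2) ((2 * (z : ℝ) + 1)⁻¹ * t) = y / (x + 1) := by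
    rw [lerchKernel, hy, hx]
    congr 2
    · push_cast; field_simp; norm_num
    · congr 1; push_cast; field_simp
  have hL (i : ℕ) (hi : i ∈ Finset.range (2 * z + 1)) :
      (-1 : ℂ) ^ i * lerchKernel (1 / 2 + ((i : ℂ) - z) / (2 * z + 1)) t
        = y / (x ^ (2 * z + 1) + 1) * ((-1) ^ i * x ^ (2 * z + 1 - 1 - i)) := by
    have hi' : i ≤ 2 * z := by have := Finset.mem_range.1 hi; omega
    rw [lerchKernel, het]
    have : Complex.exp (-(1 / 2 + ((i : ℂ) - z) / (2 * z + 1) - 1) * t)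
        = y * x ^ (2 * z + 1 - 1 - i) := by
      rw [hx, hy, ← Complex.exp_nat_mul, ← Complex.exp_add]
      congr 1
      rw [Nat.add_sub_cancel, Nat.cast_sub hi']
      push_cast
      field_simp
      ring
    rw [this]; ring
  rw [Finset.sum_congr rfl hL, ← Finset.mul_sum, hR]
  have hg := (Commute.all (-1 : ℂ) x).geom_sum₂_mul (2 * z + 1)
  have h1 : ((-1 : ℂ)) ^ (2 * z + 1) = -1 := by rw [pow_succ, pow_mul]; simp
  rw [h1] at hg
  have hg' : (∑ i ∈ Finset.range (2 * z + 1), (-1 : ℂ) ^ i * x ^ (2 * z + 1 - 1 - i))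
      = (x ^ (2 * z + 1) + 1) / (x + 1) := by
    rw [eq_div_iff hx1]; linear_combination -hg
  rw [hg']
  field_simp

theorem re_half_add_pos (z i : ℕ) :
    0 < (1 / 2 + ((i : ℂ) - z) / (2 * z + 1) : ℂ).re := by
  have h : (1 / 2 + ((i : ℂ) - z) / (2 * z + 1) : ℂ)
      = ((1 / 2 + ((i : ℝ) - z) / (2 * z + 1) : ℝ) : ℂ) := by push_cast; ring
  rw [h, Complex.ofReal_re]
  have : (1 / 2 + ((i : ℝ) - z) / (2 * z + 1) : ℝ) = (2 * i + 1) / (2 * (2 * z + 1)) := by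
    field_simp; ring
  rw [this]; positivity

/-- The multiplication formula for `Φ(-1, s, ·)` with an odd number of terms. -/
theorem sum_lerchPhi_neg_one (z : ℕ) {s : ℂ} (hs : 0 < s.re) :
    ∑ i ∈ Finset.range (2 * z + 1),
      (-1 : ℂ) ^ i * lerchPhi (-1) s (1 / 2 + ((i : ℂ) - z) / (2 * z + 1))
      = (2 * (z : ℂ) + 1) ^ s * lerchPhi (-1) s (1 / 2) := by
  have hM : (0 : ℝ) < (2 * (z : ℝ) + 1)⁻¹ := by positivity
  have h1 := mellin_comp_mul_left (lerchKernel (1 / 2)) s hM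
  have h2 : mellin (fun t => lerchKernel (1 / 2) ((2 * (z : ℝ) + 1)⁻¹ * t)) s
      = ∑ i ∈ Finset.range (2 * z + 1),
        (-1 : ℂ) ^ i * mellin (lerchKernel (1 / 2 + ((i : ℂ) - z) / (2 * z + 1))) s := by
    simp only [← sum_lerchKernel, mellin, smul_eq_mul, Finset.mul_sum]
    rw [integral_finsetSum]
    · refine Finset.sum_congr rfl fun i _ => ?_
      rw [← integral_const_mul]
      congr 1; ext t; ring
    · intro i _
      have := (mellinConvergent_lerchKernel (re_half_add_pos z i) hs).const_mul ((-1 : ℂ) ^ i)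
      refine this.congr (Eventually.of_forall fun t => ?_)
      simp only [smul_eq_mul]; ring
  have h3 : (((2 * (z : ℝ) + 1)⁻¹ : ℝ) : ℂ) ^ (-s) = (2 * (z : ℂ) + 1) ^ s := by
    rw [Complex.ofReal_inv, Complex.inv_cpow, Complex.cpow_neg, inv_inv]
    · push_cast; rfl
    · rw [Complex.arg_ofReal_of_nonneg (by positivity)]; exact Real.pi_pos.ne
  simp only [lerchPhi_neg_one]
  rw [h2, h3, smul_eq_mul] at h1
  rw [mul_left_comm, ← h1, Finset.mul_sum]
  exact Finset.sum_congr rfl fun i _ => by ring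

/-! ### The value at `v = 1/2`, `s = 1`. -/

/-- The integrand `e^{t/2}/(e^t+1)` has primitive `2 arctan (e^{t/2})`, which runs from `π/2` to
`π`. -/
theorem lerchPhi_neg_one_one_half : lerchPhi (-1) 1 (1 / 2) = Real.pi / 2 := by
  have hd (t : ℝ) : HasDerivAt (fun t => 2 * Real.arctan (Real.exp (t / 2)))
      (Real.exp (t / 2) / (Real.exp t + 1)) t := by
    have := (((hasDerivAt_id t).div_const 2).exp.arctan).const_mul 2
    convert! this using 1
    have : Real.exp t = Real.exp (t / 2) ^ 2 := by rw [← Real.exp_nat_mul]; congr 1; push_cast; ring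
    simp only [id, this]
    field_simp
    ring
  have hl : Tendsto (fun t => 2 * Real.arctan (Real.exp (t / 2))) atTop (𝓝 (2 * (Real.pi / 2))) :=
    ((tendsto_nhds_of_tendsto_nhdsWithin Real.tendsto_arctan_atTop).comp
      (Real.tendsto_exp_atTop.comp (tendsto_id.atTop_div_const two_pos))).const_mul 2
  have hi := integral_Ioi_of_hasDerivAt_of_nonneg' (a := 0) (fun t _ => hd t)
    (fun t _ => by positivity) hl
  rw [lerchPhi_neg_one]
  have : mellin (lerchKernel (1 / 2)) 1
      = ((∫ t in Ioi (0 : ℝ), Real.exp (t / 2) / (Real.exp t + 1) : ℝ) : ℂ) := by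
    rw [mellin, ← integral_complex_ofReal]
    refine setIntegral_congr_fun measurableSet_Ioi fun t _ => ?_
    simp only [sub_self, Complex.cpow_zero, lerchKernel, one_smul]
    push_cast
    congr 2
    ring
  rw [this, hi]
  simp
  ring

/-! ### The Dirichlet beta function and its functional equation. -/

/-- `L(χ₄, s)`, the Dirichlet beta function. -/
noncomputable def dirichletBeta : ℂ → ℂ := sinZeta ((1 / 4 : ℝ) : UnitAddCircle)

theorem differentiable_dirichletBeta : Differentiable ℂ dirichletBeta :=
  differentiableAt_sinZeta _

/-- The coefficient `sin (πn/2)` vanishes at even `n` and equals `(-1)^k` at `n = 2k+1`. -/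
theorem hasSum_dirichletBeta {s : ℂ} (hs : 1 < s.re) :
    HasSum (fun k : ℕ => (-1 : ℂ) ^ k / (2 * k + 1 : ℂ) ^ s) (dirichletBeta s) := by
  have h := hasSum_nat_sinZeta (1 / 4) hs
  have hinj : Function.Injective (fun k : ℕ => 2 * k + 1) := fun a b h => by simpa using h
  rw [← hinj.hasSum_iff] at h
  · refine h.congr_fun fun k => ?_
    have : Real.sin (2 * Real.pi * (1 / 4) * ((2 * k + 1 : ℕ) : ℝ)) = (-1) ^ k := by
      have : 2 * Real.pi * (1 / 4) * ((2 * k + 1 : ℕ) : ℝ) = Real.pi / 2 + k * Real.pi := by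
        push_cast; ring
      rw [this, Real.sin_add_nat_mul_pi, Real.sin_pi_div_two, mul_one]
    simp only [Function.comp_apply, this]
    push_cast
    rfl
  · intro n hn
    have : Even n := by
      by_contra h
      obtain ⟨k, hk⟩ := Nat.not_even_iff_odd.1 h
      exact hn ⟨k, hk.symm⟩
    obtain ⟨k, rfl⟩ := this
    have : Real.sin (2 * Real.pi * (1 / 4) * ((k + k : ℕ) : ℝ)) = 0 := by
      rw [← Real.sin_nat_mul_pi k]; congr 1; push_cast; ring
    rw [this]; simp

theorem summable_one_div_two_mul_add_one_rpow {r : ℝ} (hr : 1 < r) :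
    Summable fun k : ℕ => 1 / (2 * (k : ℝ) + 1) ^ r := by
  have hinj : Function.Injective (fun k : ℕ => 2 * k + 1) := fun a b h => by simpa using h
  have := (Real.summable_one_div_nat_rpow.2 hr).comp_injective hinj
  refine this.congr fun k => ?_
  simp

/-- The kernel expands as `∑ (-1)^k e^{-(2k+1)t/2}`; absolute convergence for `Re s > 1` permits a
termwise Mellin transform. -/
theorem lerchPhi_eq_dirichletBeta_of_one_lt_re {s : ℂ} (hs : 1 < s.re) :
    lerchPhi (-1) s (1 / 2) = 2 ^ s * dirichletBeta s := by
  have hs0 : 0 < s.re := by linarith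
  have hm := hasSum_mellin (ι := ℕ) (a := fun k => (-1) ^ k) (p := fun k => (2 * k + 1) / 2)
    (F := lerchKernel (1 / 2)) (s := s) (fun k => Or.inr (by positivity)) hs0 ?_ ?_
  · have h2 := (hasSum_dirichletBeta hs).mul_left (Complex.Gamma s * 2 ^ s)
    have h3 := hm.unique (h2.congr_fun fun k => ?_)
    · rw [lerchPhi_neg_one, h3]
      have := Complex.Gamma_ne_zero_of_re_pos hs0
      field_simp
    · have : (((2 * (k : ℝ) + 1) / 2 : ℝ) : ℂ) ^ s = (2 * k + 1 : ℂ) ^ s / 2 ^ s := by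
        rw [div_eq_mul_inv, Complex.ofReal_mul, Complex.mul_cpow_ofReal_nonneg (by positivity)
          (by positivity), Complex.ofReal_inv, Complex.inv_cpow]
        · push_cast; rw [div_eq_mul_inv]
        · rw [Complex.arg_ofReal_of_nonneg (by positivity)]; exact Real.pi_pos.ne
      rw [this]
      have h2 : (2 : ℂ) ^ s ≠ 0 := by simp [Complex.cpow_eq_zero_iff]
      field_simp
  · intro t ht
    have ht : 0 < t := ht
    set x : ℂ := Complex.exp (-(t / 2)) with hx
    have hx1 : ‖-x ^ 2‖ < 1 := by
      rw [norm_neg, hx, ← Complex.exp_nat_mul, Complex.norm_exp, Real.exp_lt_one_iff]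
      simp; linarith
    have hg := (hasSum_geometric_of_norm_lt_one hx1).mul_left x
    have he : x * (1 - -x ^ 2)⁻¹ = lerchKernel (1 / 2) t := by
      have h0 : x ≠ 0 := Complex.exp_ne_zero _
      have h1 : Complex.exp t = (x ^ 2)⁻¹ := by
        rw [hx, ← Complex.exp_nat_mul, ← Complex.exp_neg]; congr 1; push_cast; ring
      have h2 : Complex.exp (-(1 / 2 - 1) * t) = x⁻¹ := by
        rw [hx, ← Complex.exp_neg]; congr 1; ring
      have h3 : 1 + x ^ 2 ≠ 0 := by
        intro h
        have h5 := exp_ofReal_add_one_ne_zero t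
        rw [h1] at h5
        apply h5
        field_simp
        rw [h, mul_zero]
      rw [lerchKernel, h1, h2, sub_neg_eq_add]
      field_simp
    rw [he] at hg
    refine hg.congr_fun fun k => ?_
    push_cast
    rw [neg_pow (x ^ 2), mul_left_comm, ← pow_mul, ← pow_succ']
    congr 1
    rw [hx, ← Complex.exp_nat_mul]
    push_cast
    congr 1; ring
  · have := (summable_one_div_two_mul_add_one_rpow hs).mul_left (2 ^ s.re)
    refine this.congr fun k => ?_
    rw [Real.div_rpow (by positivity) (by positivity)]
    simp
    field_simp

/-- Identity theorem on the half-plane `Re s > 0`; the point `s = 1` needed later lies outside the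
range of the series argument. -/
theorem lerchPhi_eq_dirichletBeta {s : ℂ} (hs : 0 < s.re) :
    lerchPhi (-1) s (1 / 2) = 2 ^ s * dirichletBeta s := by
  have ho : IsOpen {s : ℂ | 0 < s.re} := isOpen_lt continuous_const Complex.continuous_re
  have h1 : AnalyticOnNhd ℂ (fun s => lerchPhi (-1) s (1 / 2)) {s : ℂ | 0 < s.re} :=
    DifferentiableOn.analyticOnNhd (fun s hs =>
      (differentiableAt_lerchPhi_neg_one (by norm_num) hs).differentiableWithinAt) ho
  have h2 : AnalyticOnNhd ℂ (fun s => 2 ^ s * dirichletBeta s) {s : ℂ | 0 < s.re} :=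
    DifferentiableOn.analyticOnNhd (fun s _ => ((differentiableAt_id.const_cpow
      (Or.inl two_ne_zero)).mul (differentiable_dirichletBeta s)).differentiableWithinAt) ho
  refine h1.eqOn_of_preconnected_of_eventuallyEq h2 (z₀ := 2)
    (convex_halfSpace_re_gt 0).isPreconnected (by simp) ?_ hs
  filter_upwards [(isOpen_lt continuous_const Complex.continuous_re).mem_nhds
    (show (1 : ℝ) < (2 : ℂ).re by norm_num)] with w hw
  exact lerchPhi_eq_dirichletBeta_of_one_lt_re hw

/-- Even and odd `k` in the beta series give the classes 1 and 3 mod 4. The functional equation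
relates `hurwitzZetaOdd` to `sinZeta`; identifying both at `1/4` with `β` turns it into a relation
of `β` with itself. -/
theorem hurwitzZetaOdd_one_fourth_of_one_lt_re {s : ℂ} (hs : 1 < s.re) :
    hurwitzZetaOdd ((1 / 4 : ℝ) : UnitAddCircle) s = 4 ^ s / 2 * dirichletBeta s := by
  have h1 := hasSum_nat_hurwitzZetaOdd_of_mem_Icc (a := 1 / 4) (by constructor <;> norm_num) hs
  have h2 := (hasSum_dirichletBeta hs)
  have hs2 := h2.summable
  have he : Summable fun k : ℕ => (-1 : ℂ) ^ (2 * k) / (2 * ((2 * k : ℕ) : ℂ) + 1) ^ s :=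
    hs2.comp_injective (i := fun k => 2 * k) fun a b h => by simpa using h
  have ho : Summable fun k : ℕ => (-1 : ℂ) ^ (2 * k + 1) / (2 * ((2 * k + 1 : ℕ) : ℂ) + 1) ^ s :=
    hs2.comp_injective (i := fun k => 2 * k + 1) fun a b h => by simpa using h
  have h3 := h2.unique (HasSum.even_add_odd he.hasSum ho.hasSum)
  have h4 := ((he.hasSum.add ho.hasSum).mul_left (4 ^ s / 2 : ℂ))
  rw [← h3] at h4
  refine h1.unique (h4.congr_fun fun k => ?_)
  have h40 : (4 : ℂ) ^ s ≠ 0 := by simp [Complex.cpow_eq_zero_iff]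
  have key (x : ℝ) (hx : 0 ≤ x) : (x : ℂ) ^ s = ((4 * x : ℝ) : ℂ) ^ s / 4 ^ s := by
    rw [Complex.ofReal_mul, Complex.mul_cpow_ofReal_nonneg (by norm_num) hx]
    push_cast
    field_simp
  have e1 : ((k : ℂ) + ((1 / 4 : ℝ) : ℂ)) ^ s = (4 * k + 1) ^ s / 4 ^ s := by
    have := key (k + 1 / 4) (by positivity)
    push_cast at this ⊢
    rw [this]; congr 2; ring
  have e2 : ((k : ℂ) + 1 - ((1 / 4 : ℝ) : ℂ)) ^ s = (4 * k + 3) ^ s / 4 ^ s := by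
    have := key (k + 3 / 4) (by positivity)
    push_cast at this ⊢
    rw [show (k : ℂ) + 1 - 1 / 4 = k + 3 / 4 by ring, this]; congr 2; ring
  rw [e1, e2]
  push_cast
  rw [pow_succ, pow_mul, show 2 * (2 * (k : ℂ)) + 1 = 4 * k + 1 by ring,
    show 2 * (2 * (k : ℂ) + 1) + 1 = 4 * k + 3 by ring]
  simp
  ring

theorem hurwitzZetaOdd_one_fourth (s : ℂ) :
    hurwitzZetaOdd ((1 / 4 : ℝ) : UnitAddCircle) s = 4 ^ s / 2 * dirichletBeta s := by
  have h1 : AnalyticOnNhd ℂ (hurwitzZetaOdd ((1 / 4 : ℝ) : UnitAddCircle)) univ :=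
    (differentiable_hurwitzZetaOdd _).differentiableOn.analyticOnNhd isOpen_univ
  have h2 : AnalyticOnNhd ℂ (fun s => 4 ^ s / 2 * dirichletBeta s) univ :=
    DifferentiableOn.analyticOnNhd (fun s _ => (((differentiableAt_id.const_cpow
      (Or.inl (by norm_num))).div_const 2).mul
        (differentiable_dirichletBeta s)).differentiableWithinAt) isOpen_univ
  refine h1.eqOn_of_preconnected_of_eventuallyEq h2 (z₀ := 2) isPreconnected_univ (by simp) ?_
    (mem_univ s)
  filter_upwards [(isOpen_lt continuous_const Complex.continuous_re).mem_nhds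
    (show (1 : ℝ) < (2 : ℂ).re by norm_num)] with w hw
  exact hurwitzZetaOdd_one_fourth_of_one_lt_re hw

theorem dirichletBeta_one : dirichletBeta 1 = Real.pi / 4 := by
  have h := lerchPhi_eq_dirichletBeta (s := 1) (by simp)
  rw [lerchPhi_neg_one_one_half, Complex.cpow_one] at h
  linear_combination -h / 2

theorem dirichletBeta_one_sub {s : ℂ} (hs : 0 < s.re) :
    4 ^ (1 - s) / 2 * dirichletBeta (1 - s)
      = 2 * (2 * Real.pi) ^ (-s) * Complex.Gamma s * Complex.sin (Real.pi * s / 2) *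
        dirichletBeta s := by
  rw [← hurwitzZetaOdd_one_fourth, hurwitzZetaOdd_one_sub, dirichletBeta]
  intro n h
  rw [h] at hs
  simp at hs
  linarith [(Nat.cast_nonneg n : (0 : ℝ) ≤ n)]

theorem dirichletBeta_zero : dirichletBeta 0 = 1 / 2 := by
  have h := dirichletBeta_one_sub (s := 1) (by simp)
  have hp : (Real.pi : ℂ) ≠ 0 := by exact_mod_cast Real.pi_ne_zero
  rw [sub_self, Complex.cpow_zero, Complex.cpow_neg_one, Complex.Gamma_one, mul_one,
    mul_one, Complex.sin_pi_div_two, dirichletBeta_one] at h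
  field_simp at h
  linear_combination h / 4

/-- The functional equation relates the derivatives of `L(χ₄, s)` at `0` and `1`. -/
theorem deriv_dirichletBeta_one :
    deriv dirichletBeta 1 = Real.pi / 4 * (Real.log (2 * Real.pi) + Real.eulerMascheroniConstant)
      - Real.pi / 2 * (Real.log 4 / 2 + deriv dirichletBeta 0) := by
  have hp : (Real.pi : ℂ) ≠ 0 := by exact_mod_cast Real.pi_ne_zero
  have hl : HasDerivAt (fun s : ℂ => 4 ^ (1 - s) / 2 * dirichletBeta (1 - s))
      (-(Real.log 4 / 4 + deriv dirichletBeta 0 / 2)) 1 := by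
    have h0 : HasDerivAt (fun s : ℂ => 1 - s) (-1) 1 := (hasDerivAt_id _).const_sub 1
    have h1 := (h0.const_cpow (c := 4) (Or.inl (by norm_num))).div_const 2
    have h2 := (differentiable_dirichletBeta (1 - 1)).hasDerivAt.comp 1 h0
    convert! h1.mul h2 using 1
    simp [dirichletBeta_zero]
    ring
  have hr : HasDerivAt (fun s : ℂ => 2 * (2 * (Real.pi : ℂ)) ^ (-s) * Complex.Gamma s *
      Complex.sin (Real.pi * s / 2) * dirichletBeta s)
      (1 / Real.pi * (-(Real.log (2 * Real.pi) + Real.eulerMascheroniConstant) * (Real.pi / 4)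
        + deriv dirichletBeta 1)) 1 := by
    have h1 := ((hasDerivAt_neg (1 : ℂ)).const_cpow (c := 2 * (Real.pi : ℂ))
      (Or.inl (by simp))).const_mul 2
    -- The sine factor is stationary at `s = 1`, so it contributes only its value 1.
    have h2 : HasDerivAt (fun s : ℂ => Complex.sin (Real.pi * s / 2)) 0 1 := by
      have := (((hasDerivAt_id (1 : ℂ)).const_mul (Real.pi : ℂ)).div_const 2).csin
      simpa using this
    have h3 := (((h1.mul Complex.hasDerivAt_Gamma_one).mul h2).mul
      (differentiable_dirichletBeta 1).hasDerivAt)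
    convert! h3 using 1
    rw [Complex.ofReal_log (by positivity)]
    simp [dirichletBeta_one, Complex.cpow_neg_one]
    field_simp
    ring
  have hE : (fun s : ℂ => 4 ^ (1 - s) / 2 * dirichletBeta (1 - s)) =ᶠ[𝓝 1]
      fun s : ℂ => 2 * (2 * (Real.pi : ℂ)) ^ (-s) * Complex.Gamma s *
        Complex.sin (Real.pi * s / 2) * dirichletBeta s := by
    filter_upwards [(isOpen_lt continuous_const Complex.continuous_re).mem_nhds
      (show (0 : ℝ) < (1 : ℂ).re by norm_num)] with w hw
    exact dirichletBeta_one_sub hw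
  have := hl.unique (hr.congr_of_eventuallyEq hE)
  field_simp at this
  linear_combination -this / 8

/-! ### A second-difference series for `2^s β(s)` and the derivative at `0`. -/

theorem rpow_neg_sub_rpow_neg_bounds {a b s : ℝ} (ha : 0 < a) (hab : a < b) (hs : 0 < s) :
    s * (b - a) * b ^ (-s - 1) ≤ a ^ (-s) - b ^ (-s) ∧
      a ^ (-s) - b ^ (-s) ≤ s * (b - a) * a ^ (-s - 1) := by
  obtain ⟨c, hc, hc'⟩ := exists_hasDerivAt_eq_slope (fun x : ℝ => x ^ (-s))
    (fun x => -s * x ^ (-s - 1)) hab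
    (fun x hx => (Real.continuousAt_rpow_const _ _
      (Or.inl (ha.trans_le hx.1).ne')).continuousWithinAt)
    (fun x hx => Real.hasDerivAt_rpow_const (Or.inl (ha.trans hx.1).ne'))
  have hba : 0 < b - a := sub_pos.2 hab
  have h : a ^ (-s) - b ^ (-s) = s * (b - a) * c ^ (-s - 1) := by
    rw [eq_div_iff hba.ne'] at hc'
    linarith
  have hc0 : 0 < c := ha.trans hc.1
  rw [h]
  constructor
  · gcongr ?_ * ?_
    exact Real.rpow_le_rpow_of_nonpos hc0 hc.2.le (by linarith)
  · gcongr ?_ * ?_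
    exact Real.rpow_le_rpow_of_nonpos ha hc.1.le (by linarith)

/-- The second difference of `x ↦ x ^ (-s)` at `x = 2 k + 1 / 2`. -/
noncomputable def secondDiff (s : ℝ) (k : ℕ) : ℝ :=
  (2 * k + 1 / 2 : ℝ) ^ (-s) - 2 * (2 * k + 3 / 2 : ℝ) ^ (-s) + (2 * k + 5 / 2 : ℝ) ^ (-s)

theorem secondDiff_nonneg {s : ℝ} (hs : 0 < s) (k : ℕ) : 0 ≤ secondDiff s k := by
  have h1 := (rpow_neg_sub_rpow_neg_bounds (a := 2 * k + 1 / 2) (b := 2 * k + 3 / 2)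
    (by positivity) (by linarith) hs).1
  have h2 := (rpow_neg_sub_rpow_neg_bounds (a := 2 * k + 3 / 2) (b := 2 * k + 5 / 2)
    (by positivity) (by linarith) hs).2
  unfold secondDiff
  ring_nf at h1 h2 ⊢
  linarith

/-- The factor `s` survives division by `s`, so the bound dominates `secondDiff s k / s` uniformly
as `s → 0`. The constant is `8 = 2·2·2`: from `s + 1 ≤ 2`, the interval length 2, and `x^{-s} ≤ 2`
for `x ≥ 1/2`. -/
theorem secondDiff_le {s : ℝ} (hs : 0 < s) (hs1 : s ≤ 1) (k : ℕ) :
    secondDiff s k ≤ s * (8 * (1 / (2 * k + 1 / 2 : ℝ) ^ 2)) := by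
  have hx : (1 / 2 : ℝ) ≤ 2 * k + 1 / 2 := by linarith [(Nat.cast_nonneg k : (0 : ℝ) ≤ k)]
  have hx0 : (0 : ℝ) < 2 * k + 1 / 2 := by positivity
  have h1 := (rpow_neg_sub_rpow_neg_bounds (a := 2 * k + 1 / 2) (b := 2 * k + 3 / 2)
    (by positivity) (by linarith) hs).2
  have h2 := (rpow_neg_sub_rpow_neg_bounds (a := 2 * k + 3 / 2) (b := 2 * k + 5 / 2)
    (by positivity) (by linarith) hs).1
  -- The mean value bound a second time, now for `x^{-s-1}`, the power produced by the two first
  -- differences.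
  have h3 := (rpow_neg_sub_rpow_neg_bounds (a := 2 * k + 1 / 2) (b := 2 * k + 5 / 2)
    (s := s + 1) (by positivity) (by linarith) (by linarith)).2
  have h4 : (2 * k + 1 / 2 : ℝ) ^ (-(s + 1) - 1) ≤ 2 * (1 / (2 * k + 1 / 2 : ℝ) ^ 2) := by
    have e : -(s + 1) - 1 = -s + -2 := by ring
    rw [e, Real.rpow_add hx0, Real.rpow_neg hx0.le 2, Real.rpow_two, ← one_div]
    refine mul_le_mul_of_nonneg_right ?_ (one_div_nonneg.2 (sq_nonneg _))
    calc (2 * k + 1 / 2 : ℝ) ^ (-s) ≤ (1 / 2) ^ (-s) :=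
          Real.rpow_le_rpow_of_nonpos (by norm_num) hx (by linarith)
      _ = 2 ^ s := by rw [one_div, Real.inv_rpow (by norm_num), Real.rpow_neg (by norm_num), inv_inv]
      _ ≤ 2 ^ (1 : ℝ) := Real.rpow_le_rpow_of_exponent_le (by norm_num) hs1
      _ = 2 := by simp
  have h5 : (s + 1) * (2 * k + 5 / 2 - (2 * k + 1 / 2)) * (2 * k + 1 / 2 : ℝ) ^ (-(s + 1) - 1)
      ≤ (1 + 1) * 2 * (2 * (1 / (2 * k + 1 / 2 : ℝ) ^ 2)) := by
    have h7 : (2 * k + 5 / 2 - (2 * k + 1 / 2) : ℝ) = 2 := by ring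
    rw [h7]
    gcongr
  have h6 := mul_le_mul_of_nonneg_left (h3.trans h5) hs.le
  unfold secondDiff
  ring_nf at h1 h2 h6 ⊢
  linarith

theorem summable_secondDiff_bound :
    Summable fun k : ℕ => 8 * (1 / (2 * k + 1 / 2 : ℝ) ^ 2) := by
  refine Summable.mul_left _ ?_
  have := (Real.summable_one_div_nat_add_rpow (1 / 4) 2).2 (by norm_num)
  refine (this.mul_left (1 / 4)).congr fun k => ?_
  rw [abs_of_pos (by positivity), Real.rpow_two]
  field_simp
  ring

theorem summable_secondDiff {s : ℝ} (hs : 0 < s) (hs1 : s ≤ 1) : Summable (secondDiff s) :=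
  Summable.of_nonneg_of_le (secondDiff_nonneg hs) (secondDiff_le hs hs1)
    (summable_secondDiff_bound.mul_left s)

theorem integrableOn_rpow_mul_exp_neg_mul {a r : ℝ} (ha : 0 < a) (hr : 0 < r) :
    IntegrableOn (fun t : ℝ => t ^ (a - 1) * Real.exp (-(r * t))) (Ioi 0) := by
  -- A Bochner integral of a non-integrable function is 0, so the known positive value proves
  -- integrability.
  refine Integrable.of_integral_ne_zero ?_
  rw [Real.integral_rpow_mul_exp_neg_mul_Ioi ha hr]
  have := Real.Gamma_pos_of_pos ha
  positivity

theorem hasSum_secondDiff {s : ℝ} (hs : 0 < s) (hs1 : s ≤ 1) :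
    HasSum (fun k => Real.Gamma s * secondDiff s k)
      (∫ t in Ioi (0 : ℝ), t ^ (s - 1) *
        (Real.exp (-(1 / 2 * t)) * (1 - Real.exp (-t)) / (1 + Real.exp (-t)))) := by
  let F (k : ℕ) (t : ℝ) : ℝ := t ^ (s - 1) * Real.exp (-((2 * k + 1 / 2) * t))
    - 2 * (t ^ (s - 1) * Real.exp (-((2 * k + 3 / 2) * t)))
    + t ^ (s - 1) * Real.exp (-((2 * k + 5 / 2) * t))
  -- The factored form shows that `F k` is nonnegative on `t > 0`, so its norm has the same
  -- integral, and that the `F k` form a geometric series in `k`.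
  have hF (k : ℕ) (t : ℝ) : F k t = t ^ (s - 1) * (Real.exp (-(1 / 2 * t)) *
      (1 - Real.exp (-t)) ^ 2) * (Real.exp (-t) ^ 2) ^ k := by
    have e1 : Real.exp (-((2 * k + 1 / 2) * t))
        = Real.exp (-(1 / 2 * t)) * (Real.exp (-t) ^ 2) ^ k := by
      rw [← pow_mul, ← Real.exp_nat_mul, ← Real.exp_add]; congr 1; push_cast; ring
    have e2 : Real.exp (-((2 * k + 3 / 2) * t))
        = Real.exp (-((2 * k + 1 / 2) * t)) * Real.exp (-t) := by
      rw [← Real.exp_add]; congr 1; ring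
    have e3 : Real.exp (-((2 * k + 5 / 2) * t))
        = Real.exp (-((2 * k + 1 / 2) * t)) * Real.exp (-t) ^ 2 := by
      rw [← Real.exp_nat_mul, ← Real.exp_add]; congr 1; push_cast; ring
    simp only [F, e2, e3, e1]
    ring
  have i1 (k : ℕ) := integrableOn_rpow_mul_exp_neg_mul hs (r := 2 * k + 1 / 2) (by positivity)
  have i2 (k : ℕ) := integrableOn_rpow_mul_exp_neg_mul hs (r := 2 * k + 3 / 2) (by positivity)
  have i3 (k : ℕ) := integrableOn_rpow_mul_exp_neg_mul hs (r := 2 * k + 5 / 2) (by positivity)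
  have hint (k : ℕ) : IntegrableOn (F k) (Ioi 0) := ((i1 k).sub ((i2 k).const_mul 2)).add (i3 k)
  have hval (k : ℕ) : ∫ t in Ioi (0 : ℝ), F k t = Real.Gamma s * secondDiff s k := by
    have e (r : ℝ) (hr : 0 < r) : (1 / r) ^ s = r ^ (-s) := by
      rw [one_div, Real.inv_rpow hr.le, Real.rpow_neg hr.le]
    have h := integral_add ((i1 k).sub ((i2 k).const_mul 2)) (i3 k)
    simp only [Pi.sub_apply] at h
    refine h.trans ?_
    rw [integral_sub (i1 k) ((i2 k).const_mul 2), integral_const_mul,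
      Real.integral_rpow_mul_exp_neg_mul_Ioi hs (by positivity),
      Real.integral_rpow_mul_exp_neg_mul_Ioi hs (by positivity),
      Real.integral_rpow_mul_exp_neg_mul_Ioi hs (by positivity),
      e _ (by positivity), e _ (by positivity), e _ (by positivity), secondDiff]
    ring
  have hnorm (k : ℕ) : ∫ t in Ioi (0 : ℝ), ‖F k t‖ = Real.Gamma s * secondDiff s k := by
    rw [← hval]
    refine setIntegral_congr_fun measurableSet_Ioi fun t ht => ?_
    have ht : 0 < t := ht
    simp only [hF]
    exact Real.norm_of_nonneg (by positivity)
  have := hasSum_integral_of_summable_integral_norm hint (by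
    simp only [hnorm]
    exact (summable_secondDiff hs hs1).mul_left _)
  simp only [hval] at this
  convert! this using 1
  refine setIntegral_congr_fun measurableSet_Ioi fun t ht => ?_
  have ht : 0 < t := ht
  simp only [hF]
  have hx1 : Real.exp (-t) < 1 := by rw [Real.exp_lt_one_iff]; linarith
  have hx0 := Real.exp_pos (-t)
  have hx2 : Real.exp (-t) ^ 2 < 1 := by nlinarith
  rw [tsum_mul_left, tsum_geometric_of_lt_one (by positivity) hx2]
  have h3 : 1 - Real.exp (-t) ≠ 0 := by linarith
  have h4 : 1 - Real.exp (-t) ^ 2 = (1 - Real.exp (-t)) * (1 + Real.exp (-t)) := by ring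
  rw [h4]
  field_simp

/-- With `q = e^{-t}`, the kernel `e^{-t/2}/(1+q)` is half of `e^{-t/2}` plus half of
`e^{-t/2}(1-q)/(1+q)`. The latter vanishes at `t = 0`, which makes the resulting series usable in
the limit `s → 0`. -/
theorem two_rpow_mul_dirichletBeta {s : ℝ} (hs : 0 < s) (hs1 : s ≤ 1) :
    (2 : ℂ) ^ (s : ℂ) * dirichletBeta s
      = ((1 / 2 * 2 ^ s + 1 / 2 * ∑' k, secondDiff s k : ℝ) : ℂ) := by
  have hG := Real.Gamma_pos_of_pos hs
  have h2 := hasSum_secondDiff hs hs1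
  have h3 := h2.tsum_eq
  rw [tsum_mul_left] at h3
  have hi : IntegrableOn (fun t : ℝ => t ^ (s - 1) *
      (Real.exp (-(1 / 2 * t)) * (1 - Real.exp (-t)) / (1 + Real.exp (-t)))) (Ioi 0) := by
    refine (integrableOn_rpow_mul_exp_neg_mul hs (r := 1 / 2) (by norm_num)).mono' ?_ ?_
    · refine AEStronglyMeasurable.mul ?_ ?_
      · exact (measurable_id.pow_const _).aestronglyMeasurable
      · exact Measurable.aestronglyMeasurable (by fun_prop)
    · refine (ae_restrict_mem measurableSet_Ioi).mono fun t ht => ?_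
      have ht : 0 < t := ht
      have hx1 : Real.exp (-t) < 1 := by rw [Real.exp_lt_one_iff]; linarith
      have hx0 := Real.exp_pos (-t)
      have h1x : 0 ≤ 1 - Real.exp (-t) := by linarith
      rw [Real.norm_of_nonneg (by positivity)]
      gcongr
      rw [div_le_iff₀ (by positivity)]
      gcongr
      linarith
  have hmain : mellin (lerchKernel (1 / 2)) s
      = ((Real.Gamma s * (1 / 2 * 2 ^ s + 1 / 2 * ∑' k, secondDiff s k) : ℝ) : ℂ) := by
    have h1 := Real.integral_rpow_mul_exp_neg_mul_Ioi hs (r := 1 / 2) (by norm_num)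
    rw [one_div_one_div] at h1
    have e : Real.Gamma s * (1 / 2 * 2 ^ s + 1 / 2 * ∑' k, secondDiff s k)
        = 1 / 2 * (2 ^ s * Real.Gamma s) + 1 / 2 * (Real.Gamma s * ∑' k, secondDiff s k) := by
      ring
    rw [e, h3, ← h1, ← integral_const_mul, ← integral_const_mul, ← integral_add
      ((integrableOn_rpow_mul_exp_neg_mul hs (by norm_num)).const_mul _) (hi.const_mul _),
      ← integral_complex_ofReal, mellin]
    refine setIntegral_congr_fun measurableSet_Ioi fun t ht => ?_
    have ht : 0 < t := ht
    have hk : lerchKernel (1 / 2) t = ((Real.exp (1 / 2 * t) / (Real.exp t + 1) : ℝ) : ℂ) := by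
      rw [lerchKernel]; push_cast; congr 2; ring
    have hc : (t : ℂ) ^ ((s : ℂ) - 1) = ((t ^ (s - 1) : ℝ) : ℂ) := by
      rw [Complex.ofReal_cpow ht.le]; push_cast; rfl
    simp only [hk, hc, smul_eq_mul]
    rw [← Complex.ofReal_mul]
    congr 1
    set y := Real.exp (1 / 2 * t) with hy
    have hy0 : 0 < y := Real.exp_pos _
    have e1 : Real.exp (-(1 / 2 * t)) = y⁻¹ := by rw [hy, Real.exp_neg]
    have e2 : Real.exp t = y ^ 2 := by rw [hy, ← Real.exp_nat_mul]; congr 1; push_cast; ring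
    have e3 : Real.exp (-t) = (y ^ 2)⁻¹ := by rw [Real.exp_neg, e2]
    rw [e1, e2, e3]
    field_simp
    ring
  rw [← lerchPhi_eq_dirichletBeta (by simpa using hs), lerchPhi_neg_one, hmain,
    Complex.Gamma_ofReal]
  have : (Real.Gamma s : ℂ) ≠ 0 := by exact_mod_cast hG.ne'
  push_cast
  field_simp

/-- The derivative at `s = 0` of `secondDiff s k`. -/
noncomputable def logSecondDiff (k : ℕ) : ℝ :=
  -Real.log (2 * k + 1 / 2) + 2 * Real.log (2 * k + 3 / 2) - Real.log (2 * k + 5 / 2)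

theorem tendsto_tsum_secondDiff_div :
    Tendsto (fun s : ℝ => ∑' k, s⁻¹ * secondDiff s k) (𝓝[>] 0) (𝓝 (∑' k, logSecondDiff k)) := by
  refine tendsto_tsum_of_dominated_convergence summable_secondDiff_bound (fun k => ?_) ?_
  · have e (r : ℝ) (hr : 0 < r) : HasDerivAt (fun s : ℝ => r ^ (-s)) (-Real.log r) 0 := by
      have := (hasDerivAt_neg (0 : ℝ)).const_rpow hr
      simpa using this
    have h := ((e (2 * k + 1 / 2) (by positivity)).sub
      ((e (2 * k + 3 / 2) (by positivity)).const_mul 2)).add (e (2 * k + 5 / 2) (by positivity))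
    have h2 := h.tendsto_slope_zero_right
    have e0 : -Real.log (2 * k + 1 / 2) - 2 * -Real.log (2 * k + 3 / 2)
        + -Real.log (2 * k + 5 / 2) = logSecondDiff k := by rw [logSecondDiff]; ring
    rw [e0] at h2
    refine h2.congr fun s => ?_
    simp only [Pi.add_apply, Pi.sub_apply, secondDiff, zero_add, neg_zero, Real.rpow_zero,
      smul_eq_mul]
    ring
  · filter_upwards [Ioc_mem_nhdsGT (zero_lt_one' ℝ)] with s hs k
    have hs0 := hs.1
    rw [Real.norm_of_nonneg (mul_nonneg (by positivity) (secondDiff_nonneg hs.1 k)),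
      inv_mul_le_iff₀ hs.1]
    exact secondDiff_le hs.1 hs.2 k

/-- As `β` is entire, a limit of slopes from the right determines the derivative. The terms `(log
2)/2` on both sides cancel because `β(0) = 1/2`. -/
theorem deriv_dirichletBeta_zero_eq_tsum :
    deriv dirichletBeta 0 = ((1 / 2 * ∑' k, logSecondDiff k : ℝ) : ℂ) := by
  have h0 : HasDerivAt (fun s : ℂ => (2 : ℂ) ^ s * dirichletBeta s)
      ((Real.log 2 : ℂ) * (1 / 2) + deriv dirichletBeta 0) 0 := by
    have := ((hasDerivAt_id (0 : ℂ)).const_cpow (c := 2) (Or.inl two_ne_zero)).mul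
      (differentiable_dirichletBeta 0).hasDerivAt
    convert! this using 1
    simp [dirichletBeta_zero]
  have h1 := (h0.comp_ofReal (z := 0)).tendsto_slope_zero_right
  have h2 : Tendsto (fun s : ℝ => ((1 / 2 * (s⁻¹ * (2 ^ s - 1))
      + 1 / 2 * ∑' k, s⁻¹ * secondDiff s k : ℝ) : ℂ)) (𝓝[>] 0)
      (𝓝 ((1 / 2 * Real.log 2 + 1 / 2 * ∑' k, logSecondDiff k : ℝ) : ℂ)) := by
    refine (Complex.continuous_ofReal.tendsto _).comp (Tendsto.add ?_ ?_)
    · have := ((hasDerivAt_id (0 : ℝ)).const_rpow (two_pos)).tendsto_slope_zero_right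
      refine Tendsto.const_mul _ ?_
      simpa using this
    · exact tendsto_tsum_secondDiff_div.const_mul _
  have h3 := tendsto_nhds_unique (h1.congr' ?_) h2
  · push_cast at h3 ⊢
    linear_combination h3
  · filter_upwards [Ioc_mem_nhdsGT (zero_lt_one' ℝ)] with s hs
    rw [zero_add, two_rpow_mul_dirichletBeta hs.1 hs.2, tsum_mul_left, Complex.real_smul]
    push_cast
    rw [Complex.cpow_zero, dirichletBeta_zero]
    ring

/-! ### Evaluation by the Gamma function. -/

theorem logSecondDiff_eq (k : ℕ) : logSecondDiff k =
    -Real.log (1 / 4 + k) + 2 * Real.log (3 / 4 + k) - Real.log (5 / 4 + k) := by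
  have e (a : ℝ) (ha : 0 < a) : Real.log (2 * k + 2 * a) = Real.log 2 + Real.log (a + k) := by
    rw [← Real.log_mul (by norm_num) (by positivity)]; congr 1; ring
  have e1 := e (1 / 4) (by norm_num)
  have e2 := e (3 / 4) (by norm_num)
  have e3 := e (5 / 4) (by norm_num)
  norm_num at e1 e2 e3
  norm_num [logSecondDiff, e1, e2, e3]
  ring

theorem logSecondDiff_nonneg (k : ℕ) : 0 ≤ logSecondDiff k := by
  rw [logSecondDiff_eq]
  have h : Real.log ((1 / 4 + k) * (5 / 4 + k)) ≤ Real.log ((3 / 4 + k) ^ 2) :=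
    Real.log_le_log (by positivity) (by ring_nf; linarith)
  rw [Real.log_mul (by positivity) (by positivity), Real.log_pow] at h
  push_cast at h
  linarith

theorem log_GammaSeq {a : ℝ} (ha : 0 < a) {n : ℕ} (hn : n ≠ 0) :
    Real.log (Real.GammaSeq a n) = a * Real.log n + Real.log n.factorial
      - ∑ k ∈ Finset.range (n + 1), Real.log (a + k) := by
  have hn' : (0 : ℝ) < n := by positivity
  rw [Real.GammaSeq, Real.log_div (by positivity)
    (Finset.prod_ne_zero_iff.2 fun k _ => by positivity), Real.log_mul (by positivity)
    (by positivity), Real.log_rpow hn', Real.log_prod fun k _ => by positivity]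

theorem hasSum_logSecondDiff :
    HasSum logSecondDiff (Real.log (Real.Gamma (1 / 4)) - 2 * Real.log (Real.Gamma (3 / 4))
      + Real.log (Real.Gamma (5 / 4))) := by
  -- The shift by one matches the `n + 1` factors in the denominator of `GammaSeq a n`.
  rw [hasSum_iff_tendsto_nat_of_nonneg logSecondDiff_nonneg, ← tendsto_add_atTop_iff_nat 1]
  have t (a : ℝ) (ha : 0 < a) : Tendsto (fun n => Real.log (Real.GammaSeq a n)) atTop
      (𝓝 (Real.log (Real.Gamma a))) :=
    (Real.GammaSeq_tendsto_Gamma a).log (Real.Gamma_pos_of_pos ha).ne'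
  refine (((t (1 / 4) (by norm_num)).sub ((t (3 / 4) (by norm_num)).const_mul 2)).add
    (t (5 / 4) (by norm_num))).congr' ?_
  filter_upwards [eventually_ne_atTop 0] with n hn
  rw [log_GammaSeq (by norm_num) hn, log_GammaSeq (by norm_num) hn, log_GammaSeq (by norm_num) hn]
  -- The weights `1, -2, 1` cancel `log n!`, and `1/4 - 2·(3/4) + 5/4 = 0` cancels `log n`.
  simp only [logSecondDiff_eq, Finset.sum_add_distrib, Finset.sum_sub_distrib,
    Finset.sum_neg_distrib, ← Finset.mul_sum]
  ring

theorem Gamma_five_fourths : Real.Gamma (5 / 4) = Real.Gamma (1 / 4) / 4 := by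
  have := Real.Gamma_add_one (s := 1 / 4) (by norm_num)
  rw [show (5 / 4 : ℝ) = 1 / 4 + 1 by norm_num, this]; ring

theorem log_Gamma_three_fourths : Real.log (Real.Gamma (3 / 4))
    = Real.log Real.pi + Real.log 2 / 2 - Real.log (Real.Gamma (1 / 4)) := by
  have h := Real.Gamma_mul_Gamma_one_sub (1 / 4)
  have h1 : 0 < Real.Gamma (1 / 4) := Real.Gamma_pos_of_pos (by norm_num)
  have h3 : 0 < Real.Gamma (3 / 4) := Real.Gamma_pos_of_pos (by norm_num)
  rw [show (1 - 1 / 4 : ℝ) = 3 / 4 by norm_num, show Real.pi * (1 / 4) = Real.pi / 4 by ring,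
    Real.sin_pi_div_four] at h
  have h' := congrArg Real.log h
  rw [Real.log_mul h1.ne' h3.ne', Real.log_div (by positivity) (by positivity),
    Real.log_div (by positivity) (by positivity), Real.log_sqrt (by norm_num)] at h'
  linarith

theorem deriv_dirichletBeta_zero : deriv dirichletBeta 0
    = ((2 * Real.log (Real.Gamma (1 / 4)) - 3 / 2 * Real.log 2 - Real.log Real.pi : ℝ) : ℂ) := by
  have h1 : 0 < Real.Gamma (1 / 4) := Real.Gamma_pos_of_pos (by norm_num)
  rw [deriv_dirichletBeta_zero_eq_tsum, hasSum_logSecondDiff.tsum_eq, log_Gamma_three_fourths,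
    Gamma_five_fourths, Real.log_div h1.ne' (by norm_num), show (4 : ℝ) = 2 ^ 2 by norm_num,
    Real.log_pow]
  congr 1
  push_cast
  ring

theorem deriv_dirichletBeta_one_eq : deriv dirichletBeta 1
    = ((Real.pi / 4 * (Real.eulerMascheroniConstant + 2 * Real.log 2 + 3 * Real.log Real.pi
      - 4 * Real.log (Real.Gamma (1 / 4))) : ℝ) : ℂ) := by
  rw [deriv_dirichletBeta_one, deriv_dirichletBeta_zero,
    Real.log_mul (by norm_num) Real.pi_ne_zero, show (4 : ℝ) = 2 ^ 2 by norm_num, Real.log_pow]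
  push_cast
  ring

theorem lerchPhiDeriv_neg_one_one_half : lerchPhiDeriv (-1) 1 (1 / 2)
    = ((Real.pi / 2 * (Real.eulerMascheroniConstant + 3 * Real.log 2 + 3 * Real.log Real.pi
      - 4 * Real.log (Real.Gamma (1 / 4))) : ℝ) : ℂ) := by
  have h : (fun s => lerchPhi (-1) s (1 / 2)) =ᶠ[𝓝 1] fun s => 2 ^ s * dirichletBeta s := by
    filter_upwards [(isOpen_lt continuous_const Complex.continuous_re).mem_nhds
      (show (0 : ℝ) < (1 : ℂ).re by norm_num)] with w hw
    exact lerchPhi_eq_dirichletBeta hw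
  have hd := ((hasDerivAt_id (1 : ℂ)).const_cpow (c := 2) (Or.inl two_ne_zero)).mul
    (differentiable_dirichletBeta 1).hasDerivAt
  rw [lerchPhiDeriv, h.deriv_eq]
  refine (hd.deriv).trans ?_
  rw [deriv_dirichletBeta_one_eq, dirichletBeta_one]
  simp
  ring

/-! ### Symmetric sums and the secant sum. -/

/-- Folds a sum about its centre `i = z`, which corresponds to `v = 1/2` for `Φ` and to `sec 0 = 1`
for the secants. -/
theorem sum_range_two_mul_add_one {A : Type*} [AddCommMonoid A] (z : ℕ) (g : ℕ → A) :
    ∑ i ∈ Finset.range (2 * z + 1), g i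
      = g z + ∑ j ∈ Finset.Icc 1 z, (g (z - j) + g (z + j)) := by
  have h1 : ∑ j ∈ Finset.Icc 1 z, g (z - j) = ∑ i ∈ Finset.range z, g i := by
    rw [← Finset.sum_range_reflect]
    refine Finset.sum_nbij' (fun j => j - 1) (fun i => i + 1) ?_ ?_ ?_ ?_ ?_
    · simp only [Finset.mem_Icc, Finset.mem_range]; omega
    · simp only [Finset.mem_Icc, Finset.mem_range]; omega
    · simp only [Finset.mem_Icc]; omega
    · simp
    · intro j hj
      rw [Finset.mem_Icc] at hj
      congr 1; omega
  have h2 : ∑ j ∈ Finset.Icc 1 z, g (z + j) = ∑ i ∈ Finset.range z, g (z + 1 + i) := by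
    refine Finset.sum_nbij' (fun j => j - 1) (fun i => i + 1) ?_ ?_ ?_ ?_ ?_
    · simp only [Finset.mem_Icc, Finset.mem_range]; omega
    · simp only [Finset.mem_Icc, Finset.mem_range]; omega
    · simp only [Finset.mem_Icc]; omega
    · simp
    · intro j hj
      rw [Finset.mem_Icc] at hj
      congr 1; omega
  rw [Finset.sum_add_distrib, h1, h2, show 2 * z + 1 = z + 1 + z by ring, Finset.sum_range_add,
    Finset.sum_range_succ]
  abel

/-- `∑_{|j| ≤ z} (-1)^(j+z) sec(π j / (2z+1)) = 2z+1`, with `i = j + z`. -/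
theorem sum_csec (z : ℕ) :
    ∑ i ∈ Finset.range (2 * z + 1), (-1 : ℂ) ^ i * csec (Real.pi * ((i : ℂ) - z) / (2 * z + 1))
      = 2 * z + 1 := by
  have hM : (2 * (z : ℂ) + 1) ≠ 0 := by exact_mod_cast (by positivity : (2 * (z : ℝ) + 1) ≠ 0)
  set w : ℂ := Complex.exp (2 * Real.pi * Complex.I / (2 * z + 1)) with hw
  have hprim : IsPrimitiveRoot w (2 * z + 1) := by
    have := Complex.isPrimitiveRoot_exp (2 * z + 1) (by omega)
    convert! this using 2
    push_cast; rfl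
  -- For `u = e^{iθ}`, `sec θ = 2u/(1+u²)`. Since `(-u²)^M = -1`, the quotient `2/(1+u²)` is the
  -- geometric sum of `(-u²)^k`, and `(-1)^i = (-1)^z u^M` shifts the exponents to `u^{2(k+z+1)}`.
  have hterm (i : ℕ) : (-1 : ℂ) ^ i * csec (Real.pi * ((i : ℂ) - z) / (2 * z + 1))
      = ∑ k ∈ Finset.range (2 * z + 1),
        (-1) ^ z * (-1) ^ k * (w ^ (k + z + 1)) ^ i * (w ^ (z * (k + z + 1)))⁻¹ := by
    set u : ℂ := Complex.exp (Real.pi * ((i : ℂ) - z) / (2 * z + 1) * Complex.I) with hu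
    have hu0 : u ≠ 0 := Complex.exp_ne_zero _
    have hu2 : u ^ 2 = w ^ i * (w ^ z)⁻¹ := by
      rw [hu, hw, ← Complex.exp_nat_mul, ← Complex.exp_nat_mul, ← Complex.exp_nat_mul,
        ← Complex.exp_neg, ← Complex.exp_add]
      congr 1; push_cast; field_simp; ring
    have huM : (-1 : ℂ) ^ i = (-1) ^ z * u ^ (2 * z + 1) := by
      have e : u ^ (2 * z + 1) = (-1) ^ i * ((-1) ^ z)⁻¹ := by
        rw [hu, ← Complex.exp_pi_mul_I, ← Complex.exp_nat_mul, ← Complex.exp_nat_mul,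
          ← Complex.exp_nat_mul, ← Complex.exp_neg, ← Complex.exp_add]
        congr 1; push_cast; field_simp; ring
      rw [e]; field_simp
    have hu2M : (u ^ 2) ^ (2 * z + 1) = 1 := by
      rw [hu2, mul_pow, inv_pow, ← pow_mul, ← pow_mul, mul_comm i, mul_comm z, pow_mul, pow_mul,
        hprim.pow_eq_one]
      simp
    have hodd : (-1 : ℂ) ^ (2 * z + 1) = -1 := by rw [pow_succ, pow_mul]; simp
    have hne : u ^ 2 + 1 ≠ 0 := by
      intro h
      rw [eq_neg_of_add_eq_zero_left h, hodd] at hu2M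
      norm_num at hu2M
    have hg := geom_sum_mul (-u ^ 2) (2 * z + 1)
    rw [neg_pow (u ^ 2) (2 * z + 1), hodd, hu2M] at hg
    have hcos : csec (Real.pi * ((i : ℂ) - z) / (2 * z + 1))
        = u * ∑ k ∈ Finset.range (2 * z + 1), (-u ^ 2) ^ k := by
      rw [csec, Complex.cos, neg_mul, Complex.exp_neg, ← hu]
      field_simp
      linear_combination hg
    rw [hcos, huM, Finset.mul_sum, Finset.mul_sum]
    refine Finset.sum_congr rfl fun k _ => ?_
    have e : (w ^ (k + z + 1)) ^ i * (w ^ (z * (k + z + 1)))⁻¹ = (u ^ 2) ^ (k + z + 1) := by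
      rw [hu2, mul_pow, inv_pow, ← pow_mul, ← pow_mul, ← pow_mul, mul_comm i]
    rw [mul_assoc _ _ (_ ⁻¹), e, neg_pow (u ^ 2) k]
    ring
  simp only [hterm]
  rw [Finset.sum_comm]
  -- Orthogonality: the sum over `i` vanishes unless `M` divides `k+z+1`, which for `k < M` forces
  -- `k = z`.
  have hk (k : ℕ) (hk : k ∈ Finset.range (2 * z + 1)) :
      ∑ i ∈ Finset.range (2 * z + 1),
        (-1 : ℂ) ^ z * (-1) ^ k * (w ^ (k + z + 1)) ^ i * (w ^ (z * (k + z + 1)))⁻¹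
      = if k = z then 2 * (z : ℂ) + 1 else 0 := by
    rw [← Finset.sum_mul, ← Finset.mul_sum]
    rw [Finset.mem_range] at hk
    split_ifs with h
    · subst h
      have h1 : w ^ (k + k + 1) = 1 := by rw [← two_mul, hprim.pow_eq_one]
      rw [h1, mul_comm k (k + k + 1), pow_mul, h1, ← mul_pow]
      simp
    · have h1 : w ^ (k + z + 1) ≠ 1 := by
        rw [Ne, hprim.pow_eq_one_iff_dvd]
        rintro ⟨c, hc⟩
        have : c = 1 := by
          rcases Nat.lt_trichotomy c 1 with h | h | h
          · interval_cases c; omega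
          · exact h
          · nlinarith
        subst this
        omega
      have h2 := geom_sum_mul (w ^ (k + z + 1)) (2 * z + 1)
      rw [← pow_mul, mul_comm _ (2 * z + 1), pow_mul w, hprim.pow_eq_one, one_pow, sub_self] at h2
      rw [(mul_eq_zero.1 h2).resolve_right (sub_ne_zero.2 h1)]
      simp
  rw [Finset.sum_congr rfl hk, Finset.sum_ite_eq', if_pos (by simp; omega)]

theorem neg_one_pow_sub_eq {z j : ℕ} (hj : j ≤ z) : (-1 : ℂ) ^ (z - j) = (-1) ^ (j + z) := by
  rw [show j + z = z - j + 2 * j by omega, pow_add, pow_mul]; simp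

theorem sum_Icc_csec (z : ℕ) :
    ∑ j ∈ Finset.Icc 1 z, (-1 : ℂ) ^ (j + z) * (2 * csec (Real.pi * j / (2 * z + 1)))
      = 2 * z + 1 - (-1) ^ z := by
  have h := sum_csec z
  rw [sum_range_two_mul_add_one] at h
  simp only [sub_self, mul_zero, zero_div] at h
  rw [csec, Complex.cos_zero, div_one, mul_one] at h
  rw [eq_sub_iff_add_eq']
  refine Eq.trans ?_ h
  congr 1
  refine Finset.sum_congr rfl fun j hj => ?_
  have hj := (Finset.mem_Icc.1 hj).2
  rw [neg_one_pow_sub_eq hj, add_comm z j, Nat.cast_sub hj]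
  have e1 : Real.pi * ((z : ℂ) - j - z) / (2 * z + 1) = -(Real.pi * j / (2 * z + 1)) := by ring
  have e2 : Real.pi * (((j + z : ℕ) : ℂ) - z) / (2 * z + 1) = Real.pi * j / (2 * z + 1) := by
    push_cast; ring
  rw [e1, e2, csec, csec, Complex.cos_neg, ← two_mul, mul_left_comm]

/-! ### Differentiating the multiplication formula and summing over `p`. -/

/-- The constant `log (8 e^γ π³ / Γ(1/4)⁴)`. -/
noncomputable def gammaLogConst : ℝ :=
  Real.eulerMascheroniConstant + 3 * Real.log 2 + 3 * Real.log Real.pi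
    - 4 * Real.log (Real.Gamma (1 / 4))

/-- Product rule for `M^s Φ(-1,s,1/2)` at `s = 1`. -/
theorem sum_lerchPhiDeriv (z : ℕ) :
    ∑ i ∈ Finset.range (2 * z + 1),
      (-1 : ℂ) ^ i * lerchPhiDeriv (-1) 1 (1 / 2 + ((i : ℂ) - z) / (2 * z + 1))
      = (2 * z + 1) * (Real.pi / 2 * (Real.log (2 * z + 1) + gammaLogConst)) := by
  have hM : (2 * (z : ℂ) + 1) ≠ 0 := by exact_mod_cast (by positivity : (2 * (z : ℝ) + 1) ≠ 0)
  have h1 : HasDerivAt (fun s => ∑ i ∈ Finset.range (2 * z + 1),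
      (-1 : ℂ) ^ i * lerchPhi (-1) s (1 / 2 + ((i : ℂ) - z) / (2 * z + 1)))
      (∑ i ∈ Finset.range (2 * z + 1),
      (-1 : ℂ) ^ i * lerchPhiDeriv (-1) 1 (1 / 2 + ((i : ℂ) - z) / (2 * z + 1))) 1 :=
    HasDerivAt.fun_sum fun i _ => (differentiableAt_lerchPhi_neg_one (re_half_add_pos z i)
      (by simp)).hasDerivAt.const_mul _
  have h2 := ((hasDerivAt_id (1 : ℂ)).const_cpow (c := 2 * (z : ℂ) + 1) (Or.inl hM)).mul
    (differentiableAt_lerchPhi_neg_one (s := 1) (v := 1 / 2) (by norm_num) (by simp)).hasDerivAt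
  have h3 := h1.unique (h2.congr_of_eventuallyEq ?_)
  · rw [h3]
    have e := lerchPhiDeriv_neg_one_one_half
    rw [lerchPhiDeriv] at e
    have el : Complex.log (2 * (z : ℂ) + 1) = Real.log (2 * z + 1) := by
      rw [Complex.ofReal_log (by positivity)]; push_cast; rfl
    simp only [id, Complex.cpow_one]
    rw [e, lerchPhi_neg_one_one_half, el, gammaLogConst]
    push_cast
    ring
  · filter_upwards [(isOpen_lt continuous_const Complex.continuous_re).mem_nhds
      (show (0 : ℝ) < (1 : ℂ).re by norm_num)] with s hs
    exact sum_lerchPhi_neg_one z hs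

theorem sum_Icc_lerchPhiDeriv (z : ℕ) :
    ∑ j ∈ Finset.Icc 1 z, (-1 : ℂ) ^ (j + z) *
      (lerchPhiDeriv (-1) 1 (1 / 2 - (j : ℂ) / (2 * z + 1))
        + lerchPhiDeriv (-1) 1 ((j : ℂ) / (2 * z + 1) + 1 / 2))
      = Real.pi / 2 * ((2 * z + 1) * (Real.log (2 * z + 1) + gammaLogConst)
        - (-1) ^ z * gammaLogConst) := by
  have h := sum_lerchPhiDeriv z
  rw [sum_range_two_mul_add_one] at h
  simp only [sub_self, zero_div, add_zero] at h
  rw [lerchPhiDeriv_neg_one_one_half, ← gammaLogConst] at h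
  have e : ∑ j ∈ Finset.Icc 1 z, (-1 : ℂ) ^ (j + z) *
      (lerchPhiDeriv (-1) 1 (1 / 2 - (j : ℂ) / (2 * z + 1))
        + lerchPhiDeriv (-1) 1 ((j : ℂ) / (2 * z + 1) + 1 / 2))
      = ∑ j ∈ Finset.Icc 1 z,
        ((-1 : ℂ) ^ (z - j) *
          lerchPhiDeriv (-1) 1 (1 / 2 + (((z - j : ℕ) : ℂ) - z) / (2 * z + 1))
        + (-1 : ℂ) ^ (z + j) *
          lerchPhiDeriv (-1) 1 (1 / 2 + (((z + j : ℕ) : ℂ) - z) / (2 * z + 1))) := by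
    refine Finset.sum_congr rfl fun j hj => ?_
    have hj := (Finset.mem_Icc.1 hj).2
    rw [neg_one_pow_sub_eq hj, add_comm z j, Nat.cast_sub hj]
    have e1 : 1 / 2 + ((z : ℂ) - j - z) / (2 * z + 1) = 1 / 2 - j / (2 * z + 1) := by ring
    have e2 : 1 / 2 + (((j + z : ℕ) : ℂ) - z) / (2 * z + 1) = j / (2 * z + 1) + 1 / 2 := by
      push_cast; ring
    rw [e1, e2]
    ring
  rw [e]
  push_cast at h ⊢
  linear_combination h

theorem log_ofReal_mul_I {r : ℝ} (hr : 0 < r) :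
    Complex.log (r * Complex.I) = Real.log r + Real.pi / 2 * Complex.I := by
  rw [Complex.log_ofReal_mul hr Complex.I_ne_zero, Complex.log_I]

theorem log_ofReal_mul_neg_I {r : ℝ} (hr : 0 < r) :
    Complex.log (r * -Complex.I) = Real.log r - Real.pi / 2 * Complex.I := by
  rw [Complex.log_ofReal_mul hr (neg_ne_zero.2 Complex.I_ne_zero), Complex.log_neg_I]
  ring

theorem complex_Gamma_one_fourth : Complex.Gamma (1 / 4) = Real.Gamma (1 / 4) := by
  rw [← Complex.Gamma_ofReal]; push_cast; rfl

theorem complex_Gamma_five_fourths : Complex.Gamma (5 / 4) = Real.Gamma (1 / 4) / 4 := by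
  have := congrArg (fun x : ℝ => (x : ℂ)) Gamma_five_fourths
  simp only [← Complex.Gamma_ofReal] at this
  push_cast at this
  rw [this]

theorem exp_gammaLogConst : Real.exp gammaLogConst
    = 8 * Real.exp Real.eulerMascheroniConstant * Real.pi ^ 3 / Real.Gamma (1 / 4) ^ 4 := by
  have hG : 0 < Real.Gamma (1 / 4) := Real.Gamma_pos_of_pos (by norm_num)
  rw [← Real.exp_log (show 0 < 8 * Real.exp Real.eulerMascheroniConstant * Real.pi ^ 3 /
    Real.Gamma (1 / 4) ^ 4 by positivity), Real.log_div (by positivity) (by positivity),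
    Real.log_mul (by positivity) (by positivity), Real.log_mul (by positivity) (by positivity),
    Real.log_exp, Real.log_pow, Real.log_pow, show (8 : ℝ) = 2 ^ 3 by norm_num, Real.log_pow,
    gammaLogConst]
  congr 1
  push_cast
  ring

theorem double_sum_lerchPhiDeriv (n z : ℕ) :
    (∑ p ∈ Finset.range (n + 1), ∑ j ∈ Finset.Icc 1 z,
          2 * Complex.I * Complex.exp (Complex.I * Real.pi * ((j : ℂ) + z)) *
            (2 * (z : ℂ) + 1) ^ (-(p : ℤ)) *
            (-lerchPhiDeriv (-1) 1 (1 / 2 - (j : ℂ) / (2 * z + 1))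
              - lerchPhiDeriv (-1) 1 ((j : ℂ) / (2 * z + 1) + 1 / 2)
              + Real.pi * csec (Real.pi * j / (2 * z + 1)) *
                  Complex.log (Complex.I * (2 * (z : ℂ) + 1) ^ p)))
        - Complex.I * Real.pi * ((-1 : ℂ) ^ z - 1) *
          ∑ p ∈ Finset.range (n + 1),
            (2 * (z : ℂ) + 1) ^ (-(p : ℤ)) *
              Complex.log (-(Complex.I * Complex.exp Real.eulerMascheroniConstant *
                  (Real.pi : ℂ) ^ 3 * (2 * (z : ℂ) + 1) ^ (-(p : ℤ))) /
                (32 * Complex.Gamma (5 / 4) ^ 4))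
      = -Complex.I * Real.pi * (2 * (z : ℂ) + 1) ^ (-(n : ℤ)) *
          ((2 * (z : ℂ) + 1) ^ (n + 1) *
              Complex.log (-(8 * Complex.I * Complex.exp Real.eulerMascheroniConstant *
                  (Real.pi : ℂ) ^ 3 * (2 * (z : ℂ) + 1)) / Complex.Gamma (1 / 4) ^ 4)
            + Complex.log (32 * Complex.I * Complex.exp (-Real.eulerMascheroniConstant) *
                  Complex.Gamma (5 / 4) ^ 4 * (2 * (z : ℂ) + 1) ^ n / (Real.pi : ℂ) ^ 3)) := by
  have hG : 0 < Real.Gamma (1 / 4) := Real.Gamma_pos_of_pos (by norm_num)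
  have hGc : (Real.Gamma (1 / 4) : ℂ) ≠ 0 := by exact_mod_cast hG.ne'
  have hpc : (Real.pi : ℂ) ≠ 0 := by exact_mod_cast Real.pi_ne_zero
  have hM0 : (0 : ℝ) < 2 * z + 1 := by positivity
  have hM : (2 * (z : ℂ) + 1) ≠ 0 := by exact_mod_cast hM0.ne'
  have hexp := congrArg (fun x : ℝ => (x : ℂ)) exp_gammaLogConst
  push_cast at hexp
  -- Each argument in `l1` to `l4` is a positive real times `i` or `-i`, so each principal logarithm
  -- is a real logarithm plus or minus `iπ/2`.
  have l1 (p : ℕ) : Complex.log (Complex.I * (2 * (z : ℂ) + 1) ^ p)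
      = p * Real.log (2 * z + 1) + Real.pi / 2 * Complex.I := by
    have := log_ofReal_mul_I (pow_pos hM0 p)
    rw [Real.log_pow] at this
    push_cast at this ⊢
    rw [← this, mul_comm]
  have l2 (p : ℕ) : Complex.log (-(Complex.I * Complex.exp Real.eulerMascheroniConstant *
      (Real.pi : ℂ) ^ 3 * (2 * (z : ℂ) + 1) ^ (-(p : ℤ))) / (32 * Complex.Gamma (5 / 4) ^ 4))
      = gammaLogConst - p * Real.log (2 * z + 1) - Real.pi / 2 * Complex.I := by
    have := log_ofReal_mul_neg_I (r := Real.exp gammaLogConst / (2 * z + 1) ^ p) (by positivity)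
    rw [Real.log_div (by positivity) (by positivity), Real.log_exp, Real.log_pow] at this
    push_cast at this ⊢
    rw [← this, hexp, complex_Gamma_five_fourths, zpow_neg, zpow_natCast]
    congr 1
    field_simp
    norm_num
  have l3 : Complex.log (-(8 * Complex.I * Complex.exp Real.eulerMascheroniConstant *
      (Real.pi : ℂ) ^ 3 * (2 * (z : ℂ) + 1)) / Complex.Gamma (1 / 4) ^ 4)
      = gammaLogConst + Real.log (2 * z + 1) - Real.pi / 2 * Complex.I := by
    have := log_ofReal_mul_neg_I (r := Real.exp gammaLogConst * (2 * z + 1)) (by positivity)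
    rw [Real.log_mul (by positivity) (by positivity), Real.log_exp] at this
    push_cast at this ⊢
    rw [← this, hexp, complex_Gamma_one_fourth]
    congr 1
    field_simp
  have l4 : Complex.log (32 * Complex.I * Complex.exp (-Real.eulerMascheroniConstant) *
      Complex.Gamma (5 / 4) ^ 4 * (2 * (z : ℂ) + 1) ^ n / (Real.pi : ℂ) ^ 3)
      = -gammaLogConst + n * Real.log (2 * z + 1) + Real.pi / 2 * Complex.I := by
    have := log_ofReal_mul_I (r := (2 * z + 1) ^ n / Real.exp gammaLogConst) (by positivity)
    rw [Real.log_div (by positivity) (by positivity), Real.log_exp, Real.log_pow] at this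
    push_cast at this ⊢
    rw [show -(gammaLogConst : ℂ) + n * Real.log (2 * z + 1)
      = n * Real.log (2 * z + 1) - gammaLogConst by ring, ← this, hexp,
      complex_Gamma_five_fourths, Complex.exp_neg]
    have := Complex.exp_ne_zero Real.eulerMascheroniConstant
    congr 1
    field_simp
    norm_num
  have inner (p : ℕ) : ∑ j ∈ Finset.Icc 1 z,
      2 * Complex.I * Complex.exp (Complex.I * Real.pi * ((j : ℂ) + z)) *
        (2 * (z : ℂ) + 1) ^ (-(p : ℤ)) *
        (-lerchPhiDeriv (-1) 1 (1 / 2 - (j : ℂ) / (2 * z + 1))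
          - lerchPhiDeriv (-1) 1 ((j : ℂ) / (2 * z + 1) + 1 / 2)
          + Real.pi * csec (Real.pi * j / (2 * z + 1)) *
            (p * Real.log (2 * z + 1) + Real.pi / 2 * Complex.I))
      = (2 * (z : ℂ) + 1) ^ (-(p : ℤ)) * Complex.I * Real.pi *
        (-((2 * z + 1) * (Real.log (2 * z + 1) + gammaLogConst) - (-1) ^ z * gammaLogConst)
          + (2 * z + 1 - (-1) ^ z) * (p * Real.log (2 * z + 1) + Real.pi / 2 * Complex.I)) := by
    have h1 := sum_Icc_lerchPhiDeriv z
    have h2 := sum_Icc_csec z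
    have e : ∀ j ∈ Finset.Icc 1 z, 2 * Complex.I *
          Complex.exp (Complex.I * Real.pi * ((j : ℂ) + z)) *
        (2 * (z : ℂ) + 1) ^ (-(p : ℤ)) *
        (-lerchPhiDeriv (-1) 1 (1 / 2 - (j : ℂ) / (2 * z + 1))
          - lerchPhiDeriv (-1) 1 ((j : ℂ) / (2 * z + 1) + 1 / 2)
          + Real.pi * csec (Real.pi * j / (2 * z + 1)) *
            (p * Real.log (2 * z + 1) + Real.pi / 2 * Complex.I))
        = -(2 * Complex.I * (2 * (z : ℂ) + 1) ^ (-(p : ℤ))) * ((-1 : ℂ) ^ (j + z) *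
          (lerchPhiDeriv (-1) 1 (1 / 2 - (j : ℂ) / (2 * z + 1))
            + lerchPhiDeriv (-1) 1 ((j : ℂ) / (2 * z + 1) + 1 / 2)))
          + (Complex.I * (2 * (z : ℂ) + 1) ^ (-(p : ℤ)) * Real.pi *
            (p * Real.log (2 * z + 1) + Real.pi / 2 * Complex.I)) *
            ((-1 : ℂ) ^ (j + z) * (2 * csec (Real.pi * j / (2 * z + 1)))) := by
      intro j _
      have : Complex.exp (Complex.I * Real.pi * ((j : ℂ) + z)) = (-1) ^ (j + z) := by
        rw [← Complex.exp_pi_mul_I, ← Complex.exp_nat_mul]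
        congr 1; push_cast; ring
      rw [this]; ring
    rw [Finset.sum_congr rfl e, Finset.sum_add_distrib, ← Finset.mul_sum, ← Finset.mul_sum, h1, h2]
    ring
  simp only [l1, l2, l3, l4, inner]
  clear l1 l2 l3 l4 inner
  rw [Finset.mul_sum, ← Finset.sum_sub_distrib]
  generalize (Real.log (2 * z + 1) : ℂ) = l
  generalize (gammaLogConst : ℂ) = c
  generalize (-1 : ℂ) ^ z = ε
  generalize 2 * (z : ℂ) + 1 = M at *
  -- The terms in `ε` cancel. With `a_p = M^{-p}(C - pL - iπ/2)`, the `p`-th summand is `iπ(a_p -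
  -- a_{p-1})`, and the right side is `iπ(a_n - a_{-1})`.
  induction n with
  | zero => simp; ring
  | succ n ih =>
    rw [Finset.sum_range_succ, ih]
    simp only [zpow_neg, zpow_natCast]
    push_cast
    field_simp
    ring

theorem exp_lerchPhiDeriv_one_sixth_add_five_sixths :
    Complex.exp (-(13 * (lerchPhiDeriv (-1) 1 (1 / 6) + lerchPhiDeriv (-1) 1 (5 / 6)) /
        (54 * Real.pi)))
      = (((2 : ℝ) ^ (11 / 27 : ℝ) * Real.exp (-(13 * Real.eulerMascheroniConstant / 27)) *
            Real.Gamma (1 / 4) * Real.Gamma (5 / 4) ^ (25 / 27 : ℝ) /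
          ((3 : ℝ) ^ (13 / 36 : ℝ) * Real.pi ^ (13 / 9 : ℝ)) : ℝ) : ℂ) := by
  have hG : 0 < Real.Gamma (1 / 4) := Real.Gamma_pos_of_pos (by norm_num)
  have hpc : (Real.pi : ℂ) ≠ 0 := by exact_mod_cast Real.pi_ne_zero
  -- For `z = 1` the only term is `j = 1`, giving `Φ'(-1,1,1/6) + Φ'(-1,1,5/6) = (π/2)(4C + 3 log
  -- 3)`.
  have h := sum_Icc_lerchPhiDeriv 1
  norm_num at h
  have e : -(13 * (lerchPhiDeriv (-1) 1 (1 / 6) + lerchPhiDeriv (-1) 1 (5 / 6)) /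
        (54 * Real.pi)) = ((-(13 / 108 * (4 * gammaLogConst + 3 * Real.log 3)) : ℝ) : ℂ) := by
    norm_num
    rw [h]
    field_simp
    ring
  rw [e, ← Complex.ofReal_exp]
  congr 1
  rw [Gamma_five_fourths]
  rw [← Real.exp_log (show 0 < (2 : ℝ) ^ (11 / 27 : ℝ) *
      Real.exp (-(13 * Real.eulerMascheroniConstant / 27)) *
      Real.Gamma (1 / 4) * (Real.Gamma (1 / 4) / 4) ^ (25 / 27 : ℝ) /
      ((3 : ℝ) ^ (13 / 36 : ℝ) * Real.pi ^ (13 / 9 : ℝ)) by positivity),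
    Real.log_div (by positivity) (by positivity), Real.log_mul (by positivity) (by positivity),
    Real.log_mul (by positivity) (by positivity), Real.log_mul (by positivity) (by positivity),
    Real.log_mul (by positivity) (by positivity), Real.log_exp, Real.log_rpow (by positivity),
    Real.log_rpow (by positivity), Real.log_rpow (by positivity), Real.log_rpow (by positivity),
    Real.log_div (by positivity) (by positivity), show (4 : ℝ) = 2 ^ 2 by norm_num, Real.log_pow,
    gammaLogConst]
  congr 1
  push_cast
  ring_nf

theorem mainTheorem9 :
    -- the derivatives that occur below exist
    (∀ v : ℝ, 0 < v → DifferentiableAt ℂ (fun s : ℂ => lerchPhi (-1) s v) 1) ∧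
    -- the double finite sum
    (∀ n z : ℕ, 1 ≤ z →
      (∑ p ∈ Finset.range (n + 1), ∑ j ∈ Finset.Icc 1 z,
          2 * Complex.I * Complex.exp (Complex.I * Real.pi * ((j : ℂ) + z)) *
            (2 * (z : ℂ) + 1) ^ (-(p : ℤ)) *
            (-lerchPhiDeriv (-1) 1 (1 / 2 - (j : ℂ) / (2 * z + 1))
              - lerchPhiDeriv (-1) 1 ((j : ℂ) / (2 * z + 1) + 1 / 2)
              + Real.pi * csec (Real.pi * j / (2 * z + 1)) *
                  Complex.log (Complex.I * (2 * (z : ℂ) + 1) ^ p)))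
        - Complex.I * Real.pi * ((-1 : ℂ) ^ z - 1) *
          ∑ p ∈ Finset.range (n + 1),
            (2 * (z : ℂ) + 1) ^ (-(p : ℤ)) *
              Complex.log (-(Complex.I * Complex.exp Real.eulerMascheroniConstant *
                  (Real.pi : ℂ) ^ 3 * (2 * (z : ℂ) + 1) ^ (-(p : ℤ))) /
                (32 * Complex.Gamma (5 / 4) ^ 4))
      = -Complex.I * Real.pi * (2 * (z : ℂ) + 1) ^ (-(n : ℤ)) *
          ((2 * (z : ℂ) + 1) ^ (n + 1) *
              Complex.log (-(8 * Complex.I * Complex.exp Real.eulerMascheroniConstant *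
                  (Real.pi : ℂ) ^ 3 * (2 * (z : ℂ) + 1)) / Complex.Gamma (1 / 4) ^ 4)
            + Complex.log (32 * Complex.I * Complex.exp (-Real.eulerMascheroniConstant) *
                  Complex.Gamma (5 / 4) ^ 4 * (2 * (z : ℂ) + 1) ^ n / (Real.pi : ℂ) ^ 3))) ∧
    -- the case `n = 2`, `z = 1`, exponentiated
    Complex.exp (-(13 * (lerchPhiDeriv (-1) 1 (1 / 6) + lerchPhiDeriv (-1) 1 (5 / 6)) /
        (54 * Real.pi)))
      = (((2 : ℝ) ^ (11 / 27 : ℝ) * Real.exp (-(13 * Real.eulerMascheroniConstant / 27)) *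
            Real.Gamma (1 / 4) * Real.Gamma (5 / 4) ^ (25 / 27 : ℝ) /
          ((3 : ℝ) ^ (13 / 36 : ℝ) * Real.pi ^ (13 / 9 : ℝ)) : ℝ) : ℂ) := by
  refine ⟨fun v hv => differentiableAt_lerchPhi_neg_one (by simpa using hv) (by simp),
    fun n z _ => double_sum_lerchPhiDeriv n z, exp_lerchPhiDeriv_one_sixth_add_five_sixths⟩
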